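/- Let $(W,S)$ be a finite Coxeter system with length function $\ell$, and let $k$ be a field. For $J\subseteq S$ let $X_J=\{w\in W:\ell(ws)>\ell(w)\text{ for all }s\in J\}$ and $x_J=\sum_{w\in X_J}w$. For a commutative ring $R$ let $\mathscr D_R\subseteq RW$ be Solomon's descent algebra, i.e. the subalgebra of the group algebra spanned by the elements $x_J$, $J\subseteq S$. Write $\operatorname{Rad}(\mathscr D_k)$ for its Jacobson radical when $R=k$, and $\operatorname{Rad}^n(\mathscr D_k)$ for the $n$-th power of this radical. For $J,K\subseteq S$ write $J=_WK$ if $wJw^{-1}=K$ for some $w\in W$. For $n\ge 1$ let $\mathsf J(n)$ be the set of pairs $(\underline J,\underline K)$ of sequences $\underline J=(J_1,\dots,J_n)$, $\underline K=(K_1,\dots,K_n)$ of subsets of $S$ with $J_i=_WK_i$ for all $i$, and put $x_{\underline J,\underline K}=\prod_{i=1}^n(x_{J_i}-x_{K_i})$, the factors being taken in this order. A *basis of the radical within $\mathsf J(1)$* is a set $\Omega$ of pairs $(L,L')$ of subsets of $S$ with $L=_WL'$ such that the elements $x_L-x_{L'}$, $(L,L')\in\Omega$, form a $k$-basis of $\operatorname{Rad}(\mathscr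 D_k)$. Given such an $\Omega$, let $[\mathsf J(n)]_\Omega$ be the integer matrix with rows indexed by $\mathsf J(n)$ and columns indexed by $\Omega$ whose row at $(\underline J,\underline K)$ consists of the coefficients in $$x_{\underline J,\underline K}=\sum_{(L,L')\in\Omega}\bigl([\mathsf J(n)]_\Omega\bigr)_{(\underline J,\underline K),(L,L')}\,(x_L-x_{L'})\quad\text{in }\mathbb ZW .$$ Let $d_{W,n}(\Omega)$ be the greatest common divisor of the determinants of all $s\times s$ submatrices of $[\mathsf J(n)]_\Omega$, where $s=\dim_k\operatorname{Rad}^n(\mathscr D_k)$ (so $d_{W,n}(\Omega)=1$ by convention if $s=0$). Let $n_{W,n}(\Omega)=\operatorname{lcm}(d_{W,n}(\Omega),|W|)$, and let $n_W(\Omega)$ be the least common multiple of $|W|$ and the numbers $n_{W,n}(\Omega)$, $1\le n\le r$, where $r$ is the largest integer with $\operatorname{Rad}^r(\mathscr D_k)\ne 0$. **Corollary 9.4.** Let $\Omega$ and $\Omega'$ be two bases of the radical within $\mathsf J(1)$. Then for every $n\ge 1$ the integer matrices $[\mathsf J(n)]_\Omega$ and $[\mathsf J(n)]_{\Omega'}$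 exist and are unique, and $$d_{W,n}(\Omega)=d_{W,n}(\Omega').$$ Moreover, $n_W(\Omega)=n_W(\Omega')$. -/

import Mathlib

namespace Descent

noncomputable section

section Coxeter

variable {B : Type*} {M : CoxeterMatrix B} {W : Type*} [Group W]

/-- `J =_W K`: the sets of simple reflections indexed by `J` and `K` are conjugate in `W`,
that is `w J w⁻¹ = K` (as sets of simple reflections) for some `w : W`. -/
def Conj (cs : CoxeterSystem M W) (J K : Set B) : Prop :=
  ∃ w : W, (fun g => w * g * w⁻¹) '' (cs.simple '' J) = cs.simple '' K

/-- `X_J`: the minimal length representatives of the left cosets of `W_J` in `W`. -/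
def minReps (cs : CoxeterSystem M W) (J : Set B) : Set W :=
  {w | ∀ i ∈ J, cs.length w < cs.length (w * cs.simple i)}

/-- The set `J(n)` of pairs of sequences `(J_1, …, J_n)`, `(K_1, …, K_n)` of subsets of the
generating set with `J_i =_W K_i` for all `i`. -/
abbrev PairSeq (cs : CoxeterSystem M W) (n : ℕ) : Type _ :=
  {p : (Fin n → Set B) × (Fin n → Set B) // ∀ i, Conj cs (p.1 i) (p.2 i)}

section Algebra

variable [Fintype W]

open Classical in
/-- `x_J = ∑_{w ∈ X_J} w` in the group algebra `R W`. -/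
def x (R : Type*) [CommRing R] (cs : CoxeterSystem M W) (J : Set B) : MonoidAlgebra R W :=
  ∑ w : W with w ∈ minReps cs J, MonoidAlgebra.of R W w

/-- The product `∏_{i=1}^n (x_{J_i} - x_{K_i})`, taken in this order. -/
def xProd (R : Type*) [CommRing R] (cs : CoxeterSystem M W) {n : ℕ} (p : PairSeq cs n) :
    MonoidAlgebra R W :=
  (List.ofFn fun i => x R cs (p.1.1 i) - x R cs (p.1.2 i)).prod

/-- Solomon's descent algebra over `R`, as a subalgebra of the group algebra: the subalgebra
generated by the `x_J`. (By Solomon's theorem the linear span of the `x_J` is closed under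
multiplication; it contains `1 = x_S`, so this subalgebra is that span.) -/
def descentAlgebra (R : Type*) [CommRing R] (cs : CoxeterSystem M W) :
    Subalgebra R (MonoidAlgebra R W) :=
  Algebra.adjoin R (Set.range (x R cs))

/-- The element `x_J` of the descent algebra. -/
def xD (R : Type*) [CommRing R] (cs : CoxeterSystem M W) (J : Set B) : descentAlgebra R cs :=
  ⟨x R cs J, Algebra.subset_adjoin (Set.mem_range_self J)⟩

/-- The `k`-subspace `Rad^n` of the descent algebra over the field `k`: the `n`-th power of
the Jacobson radical. -/
def radPow (k : Type*) [Field k] (cs : CoxeterSystem M W) (n : ℕ) :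
    Submodule k (descentAlgebra k cs) :=
  (Ring.jacobson (descentAlgebra k cs) ^ n).restrictScalars k

/-- The radical length: the largest `n` with `Rad^n ≠ 0`. -/
def radLength (k : Type*) [Field k] (cs : CoxeterSystem M W) : ℕ :=
  sSup {n : ℕ | radPow k cs n ≠ ⊥}

/-- `Ω` is (the index set of) a basis of the radical within `J(1)`: it consists of pairs
`(L, L')` with `L =_W L'`, and the elements `x_L - x_{L'}` with `(L, L') ∈ Ω` form a
`k`-basis of the Jacobson radical of the descent algebra over `k`. -/
structure IsRadBasis (k : Type*) [Field k] (cs : CoxeterSystem M W)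
    (Ω : Finset (Set B × Set B)) : Prop where
  conj : ∀ ω ∈ Ω, Conj cs ω.1 ω.2
  linearIndependent : LinearIndependent k (fun ω : Ω => xD k cs ω.1.1 - xD k cs ω.1.2)
  span_eq : Submodule.span k (Set.range fun ω : Ω => xD k cs ω.1.1 - xD k cs ω.1.2) =
    (Ring.jacobson (descentAlgebra k cs)).restrictScalars k

/-- `A` is the matrix `[J(n)]` with respect to `Ω`: the row of `A` at `p ∈ J(n)` consists of the
(integer) coefficients of the `x_L - x_{L'}`, `(L, L') ∈ Ω`, in the product attached to `p`. -/
def IsCoeffMatrix (cs : CoxeterSystem M W) (n : ℕ) (Ω : Finset (Set B × Set B))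
    (A : Matrix (PairSeq cs n) Ω ℤ) : Prop :=
  ∀ p : PairSeq cs n,
    xProd ℤ cs p = ∑ ω : Ω, A p ω • (x ℤ cs ω.1.1 - x ℤ cs ω.1.2)

open Classical in
/-- The matrix `[J(n)]` with respect to `Ω` (`0` if there is no such integer matrix). -/
def coeffMatrix (cs : CoxeterSystem M W) (n : ℕ) (Ω : Finset (Set B × Set B)) :
    Matrix (PairSeq cs n) Ω ℤ :=
  if h : ∃ A, IsCoeffMatrix cs n Ω A then h.choose else 0

end Algebra

end Coxeter

open Classical in
/-- The greatest common divisor of the determinants of all `s × s` submatrices of `A`. The rows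
and columns of a submatrix are listed in every possible order, which only changes the signs of
the determinants. -/
def minorGcd {m n : Type*} [Fintype m] [Fintype n] (s : ℕ) (A : Matrix m n ℤ) : ℕ :=
  (Finset.univ.gcd fun q : (Fin s ↪ m) × (Fin s ↪ n) => (A.submatrix q.1 q.2).det).natAbs

section Numbers

variable {B : Type*} [Fintype B] {M : CoxeterMatrix B} {W : Type*} [Group W] [Fintype W]

open Classical in
/-- `d_{W,n}`, computed with `Ω`: the greatest common divisor of the `s × s` minors of `[J(n)]`,
where `s = dim_k Rad^n`. -/
def dW (k : Type*) [Field k] (cs : CoxeterSystem M W) (Ω : Finset (Set B × Set B))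
    (n : ℕ) : ℕ :=
  minorGcd (Module.finrank k (radPow k cs n)) (coeffMatrix cs n Ω)

/-- `n_{W,n} = lcm(d_{W,n}, |W|)`, computed with `Ω`. -/
def nWn (k : Type*) [Field k] (cs : CoxeterSystem M W) (Ω : Finset (Set B × Set B))
    (n : ℕ) : ℕ :=
  Nat.lcm (dW k cs Ω n) (Fintype.card W)

/-- `n_W`, computed with `Ω`: the least common multiple of `|W|` and the `n_{W,n}` for
`1 ≤ n ≤ ℓ`, where `ℓ` is the radical length. (Every `n_{W,n}` is a multiple of `|W|`, so `|W|`
matters only if `ℓ = 0`; then `n_W = |W|`.) -/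
def nW (k : Type*) [Field k] (cs : CoxeterSystem M W) (Ω : Finset (Set B × Set B)) : ℕ :=
  Nat.lcm (Fintype.card W) ((Finset.Icc 1 (radLength k cs)).lcm (nWn k cs Ω))

end Numbers

end

end Descent

/-! Two coefficient matrices differ by an integral change of basis on the right
(`IsRadBasis.exists_coeffMatrix_eq_mul`), and the gcd of the `s × s` minors of `A` divides that of
`A * P`, by half of Cauchy–Binet. Using this in both directions gives the equality; the work is to
pass from `k` to `ℤ`.

By Solomon's formula `x_J` acts triangularly on the `x_K`, with diagonal entries (`mark`) that
depend only on the class of `J`. A difference of conjugates therefore acts strictly triangularly,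
all its left multiples are nilpotent, and it lies in the radical over any field
(`xD_sub_xD_mem_jacobson`). Conversely, the table of marks is triangular with nonzero diagonal, so
an integral combination of the `x_J` that acts strictly triangularly lies in `conjSpan`
(`sum_mem_conjSpan`). Hence `conjSpan` is closed under products.

Finally, read `Ω` as a graph on the subsets of the generating set. Whether a difference of two
vertices lies in the span of the edges is a matter of connectivity, not of the ring
(`single_sub_single_mem_span_edgeVec`), and independence over `k` implies independence over `ℤ`
(`linearIndependent_edgeVec_int`). So `Ω` gives a `ℤ`-basis of `conjSpan`. -/

namespace Descent

/-! ### The inversion cocycle and its relation to length. -/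

section Cocycle

variable {B : Type*} {M : CoxeterMatrix B} {W : Type*} [Group W] (cs : CoxeterSystem M W)

theorem functionEnd_mul_apply {α : Type*} (f g : Function.End α) (a : α) :
    (f * g) a = f (g a) := rfl

theorem functionEnd_one_apply {α : Type*} (a : α) : (1 : Function.End α) a = a := rfl

open Classical in
/-- The action of a simple reflection on signed elements of `W`. -/
noncomputable def signedSimple (i : B) : Function.End (W × ZMod 2) := fun p =>
  (cs.simple i * p.1 * (cs.simple i)⁻¹, p.2 + if p.1 = cs.simple i then 1 else 0)

open Classical in
theorem signedSimple_mul_pow (i j : B) (n : ℕ) (t : W) (e : ZMod 2) :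
    ((signedSimple cs i * signedSimple cs j) ^ n) (t, e) =
      ((cs.simple i * cs.simple j) ^ n * t * ((cs.simple i * cs.simple j) ^ n)⁻¹,
        e + ∑ l ∈ Finset.range (2 * n),
          if t = cs.simple j * (cs.simple i * cs.simple j) ^ l then 1 else 0) := by
  induction n with
  | zero => simp [functionEnd_one_apply]
  | succ n ih =>
    have hinv : cs.simple j * (cs.simple i * cs.simple j) * cs.simple j =
        (cs.simple i * cs.simple j)⁻¹ := by
      simp [mul_assoc]
    have hpow : ∀ m : ℕ, cs.simple j * (cs.simple i * cs.simple j) ^ m * cs.simple j =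
        ((cs.simple i * cs.simple j) ^ m)⁻¹ := by
      intro m
      rw [← inv_pow, ← hinv]
      have := (conj_pow (a := cs.simple j) (b := cs.simple i * cs.simple j) (i := m)).symm
      simpa only [cs.inv_simple] using this
    generalize ha : cs.simple i * cs.simple j = a at *
    have hi : cs.simple i = a * cs.simple j := by rw [← ha]; simp [mul_assoc]
    have hj : cs.simple j * cs.simple j = 1 := cs.simple_mul_simple_self j
    have hc : ∀ m : ℕ, cs.simple j * a ^ m = (a ^ m)⁻¹ * cs.simple j := by
      intro m
      rw [← hpow, mul_assoc _ (cs.simple j) (cs.simple j), hj, mul_one]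
    have e1 : (a ^ n * t * (a ^ n)⁻¹ = cs.simple j) ↔ t = cs.simple j * a ^ (2 * n) := by
      rw [two_mul, pow_add, ← mul_assoc, hc, mul_inv_eq_iff_eq_mul, ← eq_inv_mul_iff_mul_eq,
        mul_assoc]
    have e2 : (cs.simple j * (a ^ n * t * (a ^ n)⁻¹) * (cs.simple j)⁻¹ = cs.simple i) ↔
        t = cs.simple j * a ^ (2 * n + 1) := by
      have : cs.simple j * a ^ (2 * n + 1) = (a ^ n)⁻¹ * (cs.simple j * a * a ^ n) := by
        rw [show 2 * n + 1 = n + (1 + n) by ring, pow_add, ← mul_assoc, hc, pow_add, pow_one]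
        simp only [mul_assoc]
      rw [this, hi, mul_inv_eq_iff_eq_mul, mul_assoc a, hj, mul_one, ← eq_inv_mul_iff_mul_eq,
        cs.inv_simple, mul_inv_eq_iff_eq_mul, ← eq_inv_mul_iff_mul_eq]
    rw [pow_succ', functionEnd_mul_apply, ih]
    simp only [functionEnd_mul_apply, signedSimple]
    rw [mul_add, mul_one, Finset.sum_range_succ, Finset.sum_range_succ]
    refine Prod.ext ?_ ?_
    · simp only [pow_succ', ← ha, mul_inv_rev, mul_assoc]
    · simp only [e1, e2, add_assoc]

/-- For `n = M i j` the reflections counted by `signedSimple_mul_pow` run twice through the same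
list, so the signs cancel mod 2. -/
theorem isLiftable_signedSimple : M.IsLiftable (signedSimple cs) := by
  classical
  intro i j
  funext ⟨t, e⟩
  rw [signedSimple_mul_pow, cs.simple_mul_simple_pow, two_mul, Finset.sum_range_add]
  simp only [pow_add, cs.simple_mul_simple_pow, one_mul, CharTwo.add_self_eq_zero]
  simp [functionEnd_one_apply]

/-- The action of `W` on signed elements of `W`. -/
noncomputable def signedAction : W →* Function.End (W × ZMod 2) :=
  cs.lift ⟨signedSimple cs, isLiftable_signedSimple cs⟩

/-- The inversion cocycle. On reflections `t` it is `1` if `t` is a right inversion of `w` and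
`0` otherwise. -/
noncomputable def invCocycle (w t : W) : ZMod 2 := (signedAction cs w (t, 0)).2

theorem signedAction_apply (w t : W) (e : ZMod 2) :
    signedAction cs w (t, e) = (w * t * w⁻¹, e + invCocycle cs w t) := by
  induction w using cs.simple_induction_left generalizing t e with
  | one => simp [invCocycle, functionEnd_one_apply]
  | mul_simple_left w i ih =>
    have h : ∀ e, signedAction cs (cs.simple i * w) (t, e) =
        signedAction cs (cs.simple i) (w * t * w⁻¹, e + invCocycle cs w t) := by
      intro e
      rw [map_mul, functionEnd_mul_apply, ih]
    have hs : signedAction cs (cs.simple i) = signedSimple cs i := cs.lift_apply_simple _ i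
    rw [invCocycle, h, h, hs]
    simp [signedSimple, mul_assoc, add_assoc]

theorem invCocycle_mul (a b t : W) :
    invCocycle cs (a * b) t = invCocycle cs b t + invCocycle cs a (b * t * b⁻¹) := by
  rw [invCocycle, map_mul, functionEnd_mul_apply, signedAction_apply,
    signedAction_apply, zero_add]

open Classical in
theorem invCocycle_simple (i : B) (t : W) :
    invCocycle cs (cs.simple i) t = if t = cs.simple i then 1 else 0 := by
  rw [invCocycle, signedAction, cs.lift_apply_simple]
  simp [signedSimple]

@[simp] theorem invCocycle_one (t : W) : invCocycle cs 1 t = 0 := by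
  rw [invCocycle, map_one]; rfl

theorem invCocycle_inv (a t : W) : invCocycle cs a⁻¹ t = invCocycle cs a (a⁻¹ * t * a) := by
  have h := invCocycle_mul cs a a⁻¹ t
  rw [mul_inv_cancel, invCocycle_one, inv_inv] at h
  rw [← CharTwo.sub_eq_add, eq_comm, sub_eq_zero] at h
  exact h

theorem invCocycle_self {t : W} (ht : cs.IsReflection t) : invCocycle cs t t = 1 := by
  obtain ⟨w, i, rfl⟩ := ht
  rw [invCocycle_mul, invCocycle_mul, invCocycle_inv, invCocycle_simple]
  simp [mul_assoc, add_left_comm _ (1 : ZMod 2), CharTwo.add_self_eq_zero]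

theorem invCocycle_mul_self {t : W} (ht : cs.IsReflection t) (w : W) :
    invCocycle cs (w * t) t = 1 + invCocycle cs w t := by
  rw [invCocycle_mul, invCocycle_self cs ht, mul_inv_cancel_right]

theorem mem_rightInvSeq_of_invCocycle (ω : List B) {t : W}
    (h : invCocycle cs (cs.wordProd ω) t ≠ 0) : t ∈ cs.rightInvSeq ω := by
  classical
  induction ω with
  | nil => simp at h
  | cons i ω ih =>
    rw [cs.wordProd_cons, invCocycle_mul, invCocycle_simple] at h
    rw [CoxeterSystem.rightInvSeq, List.mem_cons]
    by_cases h' : invCocycle cs (cs.wordProd ω) t = 0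
    · left
      rw [h', zero_add] at h
      have := (ite_ne_right_iff.mp h).1
      rw [← this]
      simp [mul_assoc]
    · exact Or.inr (ih h')

theorem zmod_two_cases (a : ZMod 2) : a = 0 ∨ a = 1 := by
  revert a; decide

/-- A nonzero value puts `t` in the inversion sequence of a reduced word, so the length drops.
Otherwise the same argument applies to `w * t`, where the value is flipped. -/
theorem length_mul_lt_iff {t : W} (ht : cs.IsReflection t) (w : W) :
    cs.length (w * t) < cs.length w ↔ invCocycle cs w t = 1 := by
  have key : ∀ v, invCocycle cs v t = 1 → cs.length (v * t) < cs.length v := by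
    intro v hv
    obtain ⟨ω, hω, rfl⟩ := cs.exists_isReduced v
    have hne : invCocycle cs (cs.wordProd ω) t ≠ 0 := by rw [hv]; exact one_ne_zero
    exact (cs.isRightInversion_of_mem_rightInvSeq hω
      (mem_rightInvSeq_of_invCocycle cs ω hne)).2
  refine ⟨fun h => ?_, key w⟩
  rcases zmod_two_cases (invCocycle cs w t) with h0 | h1
  · have := key (w * t) (by rw [invCocycle_mul_self cs ht, h0, add_zero])
    rw [mul_assoc, ht.mul_self, mul_one] at this
    exact absurd h this.asymm
  · exact h1

theorem length_lt_mul_iff {t : W} (ht : cs.IsReflection t) (w : W) :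
    cs.length w < cs.length (w * t) ↔ invCocycle cs w t = 0 := by
  have h1 := length_mul_lt_iff cs ht w
  have h2 := ht.length_mul_left_ne w
  rcases zmod_two_cases (invCocycle cs w t) with h | h <;> simp only [h] at h1 ⊢ <;>
    simp at h1 ⊢ <;> omega

theorem mem_minReps_iff {J : Set B} {w : W} :
    w ∈ minReps cs J ↔ ∀ i ∈ J, invCocycle cs w (cs.simple i) = 0 := by
  simp only [minReps, Set.mem_ofPred_eq, length_lt_mul_iff cs (cs.isReflection_simple _)]

end Cocycle

/-! ### Distinct indices give distinct simple reflections. -/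

section Injective
variable {B : Type*} {M : CoxeterMatrix B} {W : Type*} [Group W] (cs : CoxeterSystem M W)

/-- The coroots of the geometric representation, as functionals on `B →₀ ℝ`. -/
noncomputable def coroot (M : CoxeterMatrix B) (i : B) : Module.Dual ℝ (B →₀ ℝ) :=
  Finsupp.linearCombination ℝ fun j => -2 * Real.cos (Real.pi / M i j)

theorem coroot_single (M : CoxeterMatrix B) (i j : B) :
    coroot M i (Finsupp.single j 1) = -2 * Real.cos (Real.pi / M i j) := by
  simp [coroot]

theorem coroot_self (M : CoxeterMatrix B) (i : B) : coroot M i (Finsupp.single i 1) = 2 := by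
  simp [coroot_single]

/-- Powers of a product of two reflections are given by Chebyshev polynomials, whose values at `2
cos θ` are quotients of sines; these vanish or cancel at `θ = 2π/m`. -/
theorem isLiftable_reflection (M : CoxeterMatrix B) :
    M.IsLiftable fun i => Module.reflection (coroot_self M i) := by
  intro i j
  rcases eq_or_ne i j with rfl | hij
  · ext1 v
    simp [LinearEquiv.mul_apply, Module.involutive_reflection (coroot_self M i) v]
  by_cases h0 : M i j = 0
  · simp [h0]
  have h1 : M i j ≠ 1 := M.off_diagonal i j hij
  have hsymm : M j i = M i j := M.symmetric j i
  refine LinearEquiv.ext fun v => ?_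
  rw [Module.reflection_mul_reflection_pow_apply _ _ _ _ _ rfl,
    show (1 : (B →₀ ℝ) ≃ₗ[ℝ] (B →₀ ℝ)) v = v from rfl,
    coroot_single, coroot_single, hsymm]
  generalize hm : M i j = m at *
  -- For `m = 2` the angle is `π`, where the sine in the denominator vanishes.
  rcases eq_or_ne m 2 with rfl | h2
  · norm_num
    module
  set θ : ℝ := 2 * (Real.pi / m) with hθ
  have hm3 : (3 : ℝ) ≤ m := by
    have : 3 ≤ m := by omega
    exact_mod_cast this
  have hm0 : (m : ℝ) ≠ 0 := by positivity
  have ht : -2 * Real.cos (Real.pi / m) * (-2 * Real.cos (Real.pi / m)) - 2 =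
      2 * Real.cos θ := by
    rw [hθ, Real.cos_two_mul]; ring
  have hsin : Real.sin θ ≠ 0 := by
    refine (Real.sin_pos_of_pos_of_lt_pi (by positivity) ?_).ne'
    rw [hθ, ← mul_div_assoc, div_lt_iff₀ (by positivity)]
    nlinarith [Real.pi_pos]
  have hS : ∀ n : ℤ, (Polynomial.Chebyshev.S ℝ n).eval (2 * Real.cos θ) =
      Real.sin ((n + 1) * θ) / Real.sin θ := by
    intro n
    rw [eq_div_iff hsin, Polynomial.Chebyshev.S_two_mul_real_cos]
  rw [ht]
  have hmθ : (m : ℝ) * θ = 2 * Real.pi := by rw [hθ]; field_simp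
  obtain ⟨p, hp | hp⟩ := Nat.even_or_odd' m
  · have e1 : ((m : ℤ) - 2) / 2 = p - 1 := by omega
    have e2 : ((m : ℤ) - 1) / 2 = p - 1 := by omega
    have hz : (Polynomial.Chebyshev.S ℝ ((p : ℤ) - 1)).eval (2 * Real.cos θ) = 0 := by
      rw [hS]
      have : (((p : ℤ) - 1 : ℤ) + 1 : ℝ) * θ = Real.pi := by
        rw [hp] at hmθ
        push_cast at hmθ ⊢
        linarith
      rw [this, Real.sin_pi, zero_div]
    simp [e1, e2, hz]
  · have e1 : ((m : ℤ) - 2) / 2 = p - 1 := by omega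
    have e2 : ((m : ℤ) - 1) / 2 = p := by omega
    have e3 : ((m : ℤ) - 3) / 2 = p - 1 := by omega
    have e4 : (m : ℤ) / 2 = p := by omega
    have hz : (Polynomial.Chebyshev.S ℝ (p : ℤ)).eval (2 * Real.cos θ) +
        (Polynomial.Chebyshev.S ℝ ((p : ℤ) - 1)).eval (2 * Real.cos θ) = 0 := by
      rw [hS, hS, ← add_div]
      have : (((p : ℤ) - 1 : ℤ) + 1 : ℝ) * θ = 2 * Real.pi - (((p : ℤ) : ℝ) + 1) * θ := by
        rw [hp] at hmθ
        push_cast at hmθ ⊢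
        linarith
      rw [this, Real.sin_two_pi_sub]
      simp
    simp [e1, e2, e3, e4, hz]

theorem simple_injective : Function.Injective cs.simple := by
  intro i j h
  by_contra hij
  have key : Module.reflection (coroot_self M i) = Module.reflection (coroot_self M j) := by
    have hi := cs.lift_apply_simple (isLiftable_reflection M) i
    have hj := cs.lift_apply_simple (isLiftable_reflection M) j
    rw [h, hj] at hi
    exact hi.symm
  -- The `i`-th coordinate of the image of the `i`-th basis vector is `-1` under one reflection and
  -- `1` under the other.
  have := DFunLike.congr_fun (DFunLike.congr_fun key (Finsupp.single i 1)) i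
  rw [Module.reflection_apply_self, Module.reflection_apply] at this
  simp [Ne.symm hij] at this
  norm_num at this

end Injective

/-! ### Parabolic subgroups and minimal coset representatives. -/

section Parabolic

variable {B : Type*} {M : CoxeterMatrix B} {W : Type*} [Group W] (cs : CoxeterSystem M W)

/-- The standard parabolic subgroup `W_J`. -/
def parabolic (J : Set B) : Subgroup W := Subgroup.closure (cs.simple '' J)

theorem simple_mem_parabolic {J : Set B} {i : B} (hi : i ∈ J) : cs.simple i ∈ parabolic cs J :=
  Subgroup.subset_closure (Set.mem_image_of_mem _ hi)

theorem exists_word_of_mem_parabolic {J : Set B} {v : W} (hv : v ∈ parabolic cs J) :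
    ∃ ω : List B, (∀ i ∈ ω, i ∈ J) ∧ cs.wordProd ω = v := by
  induction hv using Subgroup.closure_induction with
  | mem x hx =>
    obtain ⟨i, hi, rfl⟩ := hx
    exact ⟨[i], by simpa using hi, by simp⟩
  | one => exact ⟨[], by simp, by simp⟩
  | mul x y _ _ hx hy =>
    obtain ⟨ω, h, rfl⟩ := hx
    obtain ⟨ω', h', rfl⟩ := hy
    refine ⟨ω ++ ω', fun i hi => ?_, cs.wordProd_append ω ω'⟩
    exact (List.mem_append.mp hi).elim (h i) (h' i)
  | inv x _ hx =>
    obtain ⟨ω, h, rfl⟩ := hx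
    exact ⟨ω.reverse, fun i hi => h i (List.mem_reverse.mp hi), cs.wordProd_reverse ω⟩

/-- Exchange: if the value at the last letter is zero, that letter cancels against an earlier one,
giving a word in `J` shorter by two. The word need not be reduced, so no reduced words inside `W_J`
are needed. -/
theorem eq_one_of_forall_invCocycle_eq_zero {J : Set B} {v : W} (hv : v ∈ parabolic cs J)
    (h : ∀ i ∈ J, invCocycle cs v (cs.simple i) = 0) : v = 1 := by
  obtain ⟨ω, hω, rfl⟩ := exists_word_of_mem_parabolic cs hv
  clear hv
  induction hn : ω.length using Nat.strong_induction_on generalizing ω with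
  | _ n ih =>
    rcases List.eq_nil_or_concat ω with rfl | ⟨ω', j, rfl⟩
    · simp
    have hj : j ∈ J := hω j (by simp)
    have h1 := h j hj
    rw [cs.wordProd_concat, invCocycle_mul_self cs (cs.isReflection_simple j)] at h1
    have hne : invCocycle cs (cs.wordProd ω') (cs.simple j) ≠ 0 := by
      intro h0
      rw [h0] at h1
      simp at h1
    obtain ⟨k, hk, hkj⟩ := List.getElem_of_mem (mem_rightInvSeq_of_invCocycle cs ω' hne)
    have he : cs.wordProd (ω'.concat j) = cs.wordProd (ω'.eraseIdx k) := by
      rw [cs.wordProd_concat, ← cs.wordProd_mul_getD_rightInvSeq, List.getD_eq_getElem _ _ hk, hkj]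
    rw [cs.length_rightInvSeq] at hk
    rw [he] at h ⊢
    refine ih _ ?_ (ω'.eraseIdx k) (fun i hi => hω i ?_) h rfl
    · rw [← hn, List.length_concat, List.length_eraseIdx_of_lt hk]
      omega
    · simp [List.mem_of_mem_eraseIdx hi]

theorem mem_parabolic_of_invCocycle {J : Set B} {u : W} (hu : u ∈ parabolic cs J) {t : W}
    (ht : invCocycle cs u t ≠ 0) : t ∈ parabolic cs J := by
  classical
  induction hu using Subgroup.closure_induction generalizing t with
  | mem x hx =>
    obtain ⟨i, hi, rfl⟩ := hx
    rw [invCocycle_simple, Ne, ite_eq_right_iff, Classical.not_imp] at ht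
    rw [ht.1]
    exact simple_mem_parabolic cs hi
  | one => simp at ht
  | mul x y hx hy ihx ihy =>
    rw [invCocycle_mul] at ht
    by_cases h : invCocycle cs y t = 0
    · rw [h, zero_add] at ht
      have := ihx ht
      rwa [(parabolic cs J).mul_mem_cancel_right ((parabolic cs J).inv_mem hy),
        (parabolic cs J).mul_mem_cancel_left hy] at this
    · exact ihy h
  | inv x hx ih =>
    rw [invCocycle_inv] at ht
    have := ih ht
    rwa [(parabolic cs J).mul_mem_cancel_right hx,
      (parabolic cs J).mul_mem_cancel_left ((parabolic cs J).inv_mem hx)] at this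

theorem simple_mem_parabolic_iff {J : Set B} {i : B} :
    cs.simple i ∈ parabolic cs J ↔ i ∈ J := by
  classical
  refine ⟨fun h => ?_, simple_mem_parabolic cs⟩
  by_contra hi
  have := eq_one_of_forall_invCocycle_eq_zero cs h fun j hj => by
    rw [invCocycle_simple, if_neg]
    intro hji
    exact hi (simple_injective cs hji ▸ hj)
  simpa [this] using cs.length_simple i

theorem exists_minimal_coset_rep (J : Set B) (w : W) :
    ∃ z, z⁻¹ * w ∈ parabolic cs J ∧
      ∀ t ∈ parabolic cs J, cs.IsReflection t → invCocycle cs z t = 0 := by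
  classical
  have hex : ∃ n, ∃ z, z⁻¹ * w ∈ parabolic cs J ∧ cs.length z = n :=
    ⟨_, w, by simp [one_mem], rfl⟩
  obtain ⟨z, hz, hn⟩ := Nat.find_spec hex
  refine ⟨z, hz, fun t ht htr => ?_⟩
  rcases zmod_two_cases (invCocycle cs z t) with h | h
  · exact h
  · have hlt := (length_mul_lt_iff cs htr z).mpr h
    rw [hn] at hlt
    refine absurd ⟨z * t, ?_, rfl⟩ (Nat.find_min hex hlt)
    rw [mul_inv_rev, mul_assoc]
    exact mul_mem (inv_mem ht) hz

/-- Minimality tested on simple reflections extends to all reflections of `W_J`, because `z` must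
coincide with a shortest element of its coset. -/
theorem invCocycle_eq_zero_of_mem_minReps {J : Set B} {z t : W} (hz : z ∈ minReps cs J)
    (ht : t ∈ parabolic cs J) (htr : cs.IsReflection t) : invCocycle cs z t = 0 := by
  obtain ⟨z', hv, hmin⟩ := exists_minimal_coset_rep cs J z
  have h1 : z'⁻¹ * z = 1 := by
    refine eq_one_of_forall_invCocycle_eq_zero cs hv fun i hi => ?_
    have h2 := (mem_minReps_iff cs).mp hz i hi
    rw [← mul_inv_cancel_left z' z, invCocycle_mul, hmin, add_zero] at h2
    · exact h2
    · exact mul_mem (mul_mem hv (simple_mem_parabolic cs hi)) (inv_mem hv)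
    · exact (cs.isReflection_simple i).conj _
  rw [← inv_mul_eq_one.mp h1]
  exact hmin t ht htr

/-- The cocycle of a product `z u` with `z` minimal and `u ∈ W_J`, on reflections in `W_J`. -/
theorem invCocycle_minReps_mul {J : Set B} {z u t : W} (hz : z ∈ minReps cs J)
    (hu : u ∈ parabolic cs J) (ht : t ∈ parabolic cs J) (htr : cs.IsReflection t) :
    invCocycle cs (z * u) t = invCocycle cs u t := by
  rw [invCocycle_mul, invCocycle_eq_zero_of_mem_minReps cs hz _ (htr.conj u), add_zero]
  exact mul_mem (mul_mem hu ht) (inv_mem hu)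

theorem minReps_unique {J : Set B} {z z' : W} (hz : z ∈ minReps cs J) (hz' : z' ∈ minReps cs J)
    (h : z⁻¹ * z' ∈ parabolic cs J) : z = z' := by
  rw [← inv_mul_eq_one]
  refine eq_one_of_forall_invCocycle_eq_zero cs h fun i hi => ?_
  rw [← invCocycle_minReps_mul cs hz h (simple_mem_parabolic cs hi) (cs.isReflection_simple i),
    mul_inv_cancel_left]
  exact (mem_minReps_iff cs).mp hz' i hi

theorem exists_mem_minReps (J : Set B) (w : W) :
    ∃ z ∈ minReps cs J, z⁻¹ * w ∈ parabolic cs J := by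
  obtain ⟨z, hz, hmin⟩ := exists_minimal_coset_rep cs J w
  exact ⟨z, (mem_minReps_iff cs).mpr fun i hi =>
    hmin _ (simple_mem_parabolic cs hi) (cs.isReflection_simple i), hz⟩

/-- The minimal length representative of the coset `w W_J`. -/
noncomputable def minRep (J : Set B) (w : W) : W := (exists_mem_minReps cs J w).choose

theorem minRep_mem (J : Set B) (w : W) : minRep cs J w ∈ minReps cs J :=
  (exists_mem_minReps cs J w).choose_spec.1

theorem minRep_inv_mul_mem (J : Set B) (w : W) : (minRep cs J w)⁻¹ * w ∈ parabolic cs J :=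
  (exists_mem_minReps cs J w).choose_spec.2

theorem minRep_eq {J : Set B} {w z : W} (hz : z ∈ minReps cs J) (h : z⁻¹ * w ∈ parabolic cs J) :
    minRep cs J w = z := by
  refine (minReps_unique cs hz (minRep_mem cs J w) ?_).symm
  have := mul_mem h (inv_mem (minRep_inv_mul_mem cs J w))
  simpa [mul_assoc] using this

/-- If `d` is minimal in `W_J d` and `d s` is not, then `d s = t d` for some simple `t ∈ J`. -/
theorem conj_mem_of_not_mem_minReps {J : Set B} {d : W} (hd : d⁻¹ ∈ minReps cs J) {i : B}
    (h : (d * cs.simple i)⁻¹ ∉ minReps cs J) : d * cs.simple i * d⁻¹ ∈ cs.simple '' J := by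
  classical
  rw [mem_minReps_iff] at h hd
  push Not at h
  obtain ⟨j, hj, hne⟩ := h
  refine ⟨j, hj, ?_⟩
  rw [mul_inv_rev, invCocycle_mul, hd j hj, zero_add, cs.inv_simple, invCocycle_simple, Ne,
    ite_eq_right_iff, Classical.not_imp] at hne
  rw [← hne.1]
  simp [mul_assoc]

theorem conj_mem_of_mem_parabolic {J : Set B} {d : W} (hd : d⁻¹ ∈ minReps cs J) {i : B}
    (h : d * cs.simple i * d⁻¹ ∈ parabolic cs J) : d * cs.simple i * d⁻¹ ∈ cs.simple '' J := by
  refine conj_mem_of_not_mem_minReps cs hd fun h' => ?_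
  have := minReps_unique cs hd h' (by simpa [mul_assoc] using h)
  have h1 : cs.simple i = 1 := by simpa using this
  simpa [h1] using cs.length_simple i

theorem invCocycle_eq_zero_of_conj_mem {J : Set B} {d : W} (hd : d⁻¹ ∈ minReps cs J) {i : B}
    (h : d * cs.simple i * d⁻¹ ∈ cs.simple '' J) : invCocycle cs d (cs.simple i) = 0 := by
  obtain ⟨j, hj, he⟩ := h
  have := (mem_minReps_iff cs).mp hd j hj
  rw [invCocycle_inv, he] at this
  simpa [mul_assoc] using this

/-- The set `d⁻¹ J d ∩ K`. -/
def interConj (J K : Set B) (d : W) : Set B :=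
  {i ∈ K | d * cs.simple i * d⁻¹ ∈ cs.simple '' J}

theorem interConj_subset (J K : Set B) (d : W) : interConj cs J K d ⊆ K := fun _ h => h.1

/-- The core of Solomon's formula. For `i ∈ K`, if `d` conjugates `s_i` into `J`, then the factor
`z` does not affect the value at `s_i`; otherwise the factor `u` does not. -/
theorem mul_mem_minReps_iff {J K : Set B} {z u d : W} (hd : d⁻¹ ∈ minReps cs J)
    (hu : u ∈ parabolic cs J) (hz : z ∈ minReps cs J) :
    u * d ∈ minReps cs K ↔
      d ∈ minReps cs K ∧ z * (u * d) ∈ minReps cs (interConj cs J K d) := by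
  have h1 : ∀ i, d * cs.simple i * d⁻¹ ∈ cs.simple '' J →
      invCocycle cs (z * (u * d)) (cs.simple i) = invCocycle cs (u * d) (cs.simple i) := by
    intro i hi
    obtain ⟨j, hj, he⟩ := hi
    rw [← mul_assoc, invCocycle_mul, invCocycle_mul cs u, ← he,
      invCocycle_minReps_mul cs hz hu (simple_mem_parabolic cs hj) (cs.isReflection_simple j)]
  have h2 : ∀ i, d * cs.simple i * d⁻¹ ∉ cs.simple '' J →
      invCocycle cs (u * d) (cs.simple i) = invCocycle cs d (cs.simple i) := by
    intro i hi
    rw [invCocycle_mul]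
    by_contra hne
    refine hi (conj_mem_of_mem_parabolic cs hd (mem_parabolic_of_invCocycle cs hu ?_))
    intro h0
    simp [h0] at hne
  simp only [mem_minReps_iff]
  constructor
  · refine fun h => ⟨fun i hi => ?_, fun i hi => (h1 i hi.2).trans (h i hi.1)⟩
    by_cases hc : d * cs.simple i * d⁻¹ ∈ cs.simple '' J
    · exact invCocycle_eq_zero_of_conj_mem cs hd hc
    · rw [← h2 i hc, h i hi]
  · rintro ⟨ha, hb⟩ i hi
    by_cases hc : d * cs.simple i * d⁻¹ ∈ cs.simple '' J
    · rw [← h1 i hc, hb i ⟨hi, hc⟩]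
    · rw [h2 i hc, ha i hi]

theorem exists_invCocycle_eq_one_iff [Finite W] (K : Set B) :
    ∃ w : W, ∀ i, invCocycle cs w (cs.simple i) = 0 ↔ i ∉ K := by
  -- The witness is the longest element of `W_K`.
  obtain ⟨w, hw, hmax⟩ := Set.exists_max_image (parabolic cs K : Set W) cs.length
    (Set.toFinite _) ⟨1, one_mem _⟩
  refine ⟨w, fun i => ⟨fun h hi => ?_, fun hi => ?_⟩⟩
  · have h1 := hmax _ (mul_mem hw (simple_mem_parabolic cs hi))
    have h2 := (length_lt_mul_iff cs (cs.isReflection_simple i) w).mpr h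
    omega
  · by_contra h
    exact hi ((simple_mem_parabolic_iff cs).mp (mem_parabolic_of_invCocycle cs hw h))

end Parabolic

/-! ### Conjugacy of subsets of the generating set. -/

section Conjugacy

variable {B : Type*} {M : CoxeterMatrix B} {W : Type*} [Group W] {cs : CoxeterSystem M W}

theorem Conj.refl (J : Set B) : Conj cs J J := ⟨1, by simp⟩

theorem Conj.symm {J K : Set B} (h : Conj cs J K) : Conj cs K J := by
  obtain ⟨w, hw⟩ := h
  refine ⟨w⁻¹, ?_⟩
  rw [← hw, Set.image_image]
  simp [mul_assoc]

theorem Conj.trans {J K L : Set B} (h : Conj cs J K) (h' : Conj cs K L) : Conj cs J L := by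
  obtain ⟨w, hw⟩ := h
  obtain ⟨v, hv⟩ := h'
  refine ⟨v * w, ?_⟩
  rw [← hv, ← hw]
  simp only [Set.image_image, mul_inv_rev, mul_assoc]

/-- The conjugacy of subsets of the generating set. -/
def conjSetoid (cs : CoxeterSystem M W) : Setoid (Set B) :=
  ⟨Conj cs, Conj.refl, Conj.symm, Conj.trans⟩

/-- The conjugating element can be chosen minimal. -/
theorem Conj.exists_minReps {J J' : Set B} (h : Conj cs J J') :
    ∃ z ∈ minReps cs J, (∀ j ∈ J, z * cs.simple j * z⁻¹ ∈ parabolic cs J') ∧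
      ∀ j ∈ J', z⁻¹ * cs.simple j * z ∈ cs.simple '' J := by
  obtain ⟨w, hw⟩ := h
  set z := minRep cs J w with hz
  have hmem : ∀ u ∈ parabolic cs J, w * u * w⁻¹ ∈ parabolic cs J' := by
    intro u hu
    have : (parabolic cs J).map (MulAut.conj w).toMonoidHom ≤ parabolic cs J' := by
      rw [parabolic, MonoidHom.map_closure, Subgroup.closure_le]
      rintro _ ⟨g, hg, rfl⟩
      refine Subgroup.subset_closure ?_
      rw [← hw]
      exact ⟨g, hg, by simp⟩
    exact this ⟨u, hu, by simp⟩
  have hu : z⁻¹ * w ∈ parabolic cs J := minRep_inv_mul_mem cs J w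
  refine ⟨z, minRep_mem cs J w, fun j hj => ?_, fun j hj => ?_⟩
  · have := hmem _ (mul_mem (mul_mem (inv_mem hu) (simple_mem_parabolic cs hj)) hu)
    simpa [mul_assoc] using this
  · have hd : (z⁻¹)⁻¹ ∈ minReps cs J := by rw [inv_inv]; exact minRep_mem cs J w
    -- Minimality of `z` upgrades membership of `z⁻¹ s_j z` in `W_J` to membership in the set of
    -- generators of `W_J`.
    have := conj_mem_of_mem_parabolic cs hd (i := j) ?_
    · simpa using this
    · obtain ⟨g, ⟨i, hi, rfl⟩, he⟩ := hw.symm ▸ Set.mem_image_of_mem cs.simple hj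
      rw [← he]
      have := mul_mem (mul_mem hu (simple_mem_parabolic cs hi)) (inv_mem hu)
      simpa [mul_assoc] using this

end Conjugacy

/-! ### Solomon's formula, independence of the `x_J`, and the table of marks. -/

section Solomon

variable {B : Type*} {M : CoxeterMatrix B} {W : Type*} [Group W] [Fintype W]
  (cs : CoxeterSystem M W)

open Classical in
/-- The set of minimal representatives of the double cosets in `W_J \ W / W_K`. -/
noncomputable def doubleReps (J K : Set B) : Finset W :=
  Finset.univ.filter fun d => d⁻¹ ∈ minReps cs J ∧ d ∈ minReps cs K

theorem mem_doubleReps {J K : Set B} {d : W} :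
    d ∈ doubleReps cs J K ↔ d⁻¹ ∈ minReps cs J ∧ d ∈ minReps cs K := by
  simp [doubleReps]

/-- Solomon's multiplication formula. -/
theorem x_mul_x (R : Type*) [CommRing R] (J K : Set B) :
    x R cs J * x R cs K = ∑ d ∈ doubleReps cs J K, x R cs (interConj cs J K d) := by
  classical
  simp only [x]
  rw [Finset.sum_mul_sum, ← Finset.sum_product', Finset.sum_sigma']
  -- Write `y = u d` with `u ∈ W_J` and `d` minimal in `W_J y`, and send `(z, y)` to `(d, z y)`.
  -- Conversely `z` is recovered from `g d⁻¹ = z u`.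
  refine Finset.sum_bij'
    (fun p _ => (⟨(minRep cs J p.2⁻¹)⁻¹, p.1 * p.2⟩ : (_ : W) × W))
    (fun q _ => (minRep cs J (q.2 * q.1⁻¹), (minRep cs J (q.2 * q.1⁻¹))⁻¹ * q.2)) ?_ ?_ ?_ ?_ ?_
  · rintro ⟨z, y⟩ h
    simp only [Finset.mem_product, Finset.mem_filter_univ] at h
    simp only [Finset.mem_sigma, Finset.mem_filter_univ, mem_doubleReps, inv_inv]
    have hu := inv_mem (minRep_inv_mul_mem cs J y⁻¹)
    rw [mul_inv_rev, inv_inv, inv_inv] at hu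
    have hd : ((minRep cs J y⁻¹)⁻¹)⁻¹ ∈ minReps cs J := by
      rw [inv_inv]; exact minRep_mem cs J _
    have := mul_mem_minReps_iff cs (K := K) hd hu h.1
    rw [mul_inv_cancel_right] at this
    exact ⟨⟨minRep_mem cs J _, (this.mp h.2).1⟩, (this.mp h.2).2⟩
  · rintro ⟨d, g⟩ h
    simp only [Finset.mem_sigma, Finset.mem_filter_univ, mem_doubleReps] at h
    simp only [Finset.mem_product, Finset.mem_filter_univ]
    refine ⟨minRep_mem cs J _, ?_⟩
    have hu := minRep_inv_mul_mem cs J (g * d⁻¹)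
    have := mul_mem_minReps_iff cs (K := K) h.1.1 hu (minRep_mem cs J (g * d⁻¹))
    rw [← mul_assoc, inv_mul_cancel_right, mul_inv_cancel_left] at this
    exact this.mpr ⟨h.1.2, h.2⟩
  · rintro ⟨z, y⟩ h
    simp only [Finset.mem_product, Finset.mem_filter_univ] at h
    have : minRep cs J (z * y * minRep cs J y⁻¹) = z := by
      refine minRep_eq cs h.1 ?_
      have := inv_mem (minRep_inv_mul_mem cs J y⁻¹)
      simpa [mul_assoc] using this
    simp [this]
  · rintro ⟨d, g⟩ h
    simp only [Finset.mem_sigma, Finset.mem_filter_univ, mem_doubleReps] at h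
    have : minRep cs J (g⁻¹ * minRep cs J (g * d⁻¹)) = d⁻¹ := by
      refine minRep_eq cs h.1.1 ?_
      have := inv_mem (minRep_inv_mul_mem cs J (g * d⁻¹))
      simpa [mul_assoc] using this
    simp [this]
  · rintro ⟨z, y⟩ _
    simp

theorem coeff_x (R : Type*) [CommRing R] (J : Set B) (w : W) [Decidable (w ∈ minReps cs J)] :
    (x R cs J).coeff w = if w ∈ minReps cs J then 1 else 0 := by
  classical
  simp [x, MonoidAlgebra.coeff_sum, Finsupp.finsetSum_apply, Finsupp.single_apply]

theorem x_univ (R : Type*) [CommRing R] : x R cs Set.univ = 1 := by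
  classical
  have : ∀ w, w ∈ minReps cs Set.univ ↔ w = 1 := by
    intro w
    refine ⟨fun h => ?_, fun h => ?_⟩
    · by_contra hw
      obtain ⟨i, hi⟩ := cs.exists_rightDescent_of_ne_one hw
      exact absurd (h i trivial) (not_lt_of_gt hi)
    · subst h
      simp [minReps]
  rw [x, Finset.sum_eq_single 1, map_one]
  · intro w hw hne
    rw [Finset.mem_filter_univ, this] at hw
    exact absurd hw hne
  · simp [this]

theorem linearIndependent_x [Finite B] (R : Type*) [CommRing R] :
    LinearIndependent R (x R cs) := by
  classical
  have := Fintype.ofFinite B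
  rw [Fintype.linearIndependent_iff]
  intro c hc
  have hsum : ∀ L : Set B, ∑ J with J ⊆ L, c J = 0 := by
    intro L
    -- This `w` lies in `X_J` exactly when `J ⊆ L`, so its coefficient is a sum over the subsets of
    -- `L`.
    obtain ⟨w, hw⟩ := exists_invCocycle_eq_one_iff cs Lᶜ
    have h := congrArg (fun a => a.coeff w) hc
    simp only [MonoidAlgebra.coeff_sum, MonoidAlgebra.coeff_smul, Finsupp.finsetSum_apply,
      Finsupp.smul_apply, coeff_x, MonoidAlgebra.coeff_zero, Finsupp.zero_apply, smul_eq_mul,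
      mul_ite, mul_one, mul_zero] at h
    rw [← Finset.sum_filter] at h
    rw [← h]
    refine Finset.sum_congr (Finset.filter_congr fun J _ => ?_) fun _ _ => rfl
    rw [mem_minReps_iff]
    exact forall₂_congr fun i _ => by rw [hw]; simp
  intro J
  induction hn : J.ncard using Nat.strong_induction_on generalizing J with
  | _ n ih =>
    have h := hsum J
    rw [Finset.sum_eq_single J] at h
    · exact h
    · intro L hL hne
      rw [Finset.mem_filter_univ] at hL
      exact ih _ (hn ▸ Set.ncard_lt_ncard (hL.ssubset_of_ne hne) (Set.toFinite _)) L rfl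
    · simp

open Classical in
/-- The coefficient of `x_K` in `x_J x_K`. -/
noncomputable def mark (J K : Set B) : ℕ :=
  ((doubleReps cs J K).filter fun d => interConj cs J K d = K).card

theorem mem_filter_mark {J K : Set B} {d : W} :
    (d ∈ doubleReps cs J K ∧ interConj cs J K d = K) ↔
      d⁻¹ ∈ minReps cs J ∧ ∀ i ∈ K, d * cs.simple i * d⁻¹ ∈ cs.simple '' J := by
  rw [mem_doubleReps]
  constructor
  · rintro ⟨⟨h1, -⟩, h3⟩
    exact ⟨h1, fun i hi => (h3.symm ▸ hi : i ∈ interConj cs J K d).2⟩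
  · rintro ⟨h1, h2⟩
    exact ⟨⟨h1, (mem_minReps_iff cs).mpr fun i hi =>
      invCocycle_eq_zero_of_conj_mem cs h1 (h2 i hi)⟩,
      (interConj_subset cs J K d).antisymm fun i hi => ⟨hi, h2 i hi⟩⟩

/-- With `z` a minimal conjugating element, `d ↦ z⁻¹ d` injects the elements counted for `J'` into
those counted for `J`. -/
theorem mark_le_of_conj {J J' : Set B} (h : Conj cs J J') (K : Set B) :
    mark cs J' K ≤ mark cs J K := by
  obtain ⟨z, hz, h1, h2⟩ := h.exists_minReps
  refine Finset.card_le_card_of_injOn (fun d => z⁻¹ * d) ?_ (mul_right_injective _).injOn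
  intro d hd
  rw [Finset.mem_coe, Finset.mem_filter, mem_filter_mark] at hd
  rw [Finset.mem_coe, Finset.mem_filter, mem_filter_mark]
  refine ⟨(mem_minReps_iff cs).mpr fun j hj => ?_, fun i hi => ?_⟩
  · rw [mul_inv_rev, inv_inv, invCocycle_mul, (mem_minReps_iff cs).mp hz j hj, zero_add]
    exact invCocycle_eq_zero_of_mem_minReps cs hd.1 (h1 j hj) ((cs.isReflection_simple j).conj z)
  · obtain ⟨j, hj, he⟩ := hd.2 i hi
    have := h2 j hj
    rw [he] at this
    simpa [mul_assoc] using this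

theorem mark_eq_of_conj {J J' : Set B} (h : Conj cs J J') (K : Set B) :
    mark cs J K = mark cs J' K :=
  (mark_le_of_conj cs h.symm K).antisymm (mark_le_of_conj cs h K)

theorem mark_self_ne_zero (J : Set B) : mark cs J J ≠ 0 := by
  classical
  rw [mark, Finset.card_ne_zero]
  refine ⟨1, ?_⟩
  rw [Finset.mem_filter, mem_filter_mark]
  refine ⟨?_, fun i hi => ?_⟩
  · simp [minReps]
  · simpa using ⟨i, hi, rfl⟩

/-- Triangularity of the table of marks: a counted `d` embeds `K` into `J` by conjugation, and equal
sizes make this onto. -/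
theorem ncard_lt_or_conj_of_mark_ne_zero [Finite B] {J K : Set B} (h : mark cs J K ≠ 0) :
    K.ncard < J.ncard ∨ Conj cs J K := by
  classical
  rw [mark, Finset.card_ne_zero] at h
  obtain ⟨d, hd⟩ := h
  rw [Finset.mem_filter, mem_filter_mark] at hd
  have hsub : (fun g => d * g * d⁻¹) '' (cs.simple '' K) ⊆ cs.simple '' J := by
    rintro _ ⟨_, ⟨i, hi, rfl⟩, rfl⟩
    exact hd.2 i hi
  have hinj : Function.Injective fun g => d * g * d⁻¹ := by
    intro a b hab
    simpa using hab
  have hK : ((fun g => d * g * d⁻¹) '' (cs.simple '' K)).ncard = K.ncard := by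
    rw [Set.ncard_image_of_injective _ hinj, Set.ncard_image_of_injective _ (simple_injective cs)]
  have hJ : (cs.simple '' J).ncard = J.ncard := Set.ncard_image_of_injective _ (simple_injective cs)
  refine or_iff_not_imp_left.mpr fun hlt => Conj.symm ⟨d, ?_⟩
  exact Set.eq_of_subset_of_ncard_le hsub (by omega) (Set.toFinite _)

end Solomon

/-! ### The integral span of conjugate differences and its products. -/

section Ideal

variable {B : Type*} {M : CoxeterMatrix B} {W : Type*} [Group W] [Fintype W]
  (R : Type*) [CommRing R] (cs : CoxeterSystem M W)

/-- The span of the differences `x_J - x_K` with `J =_W K`. -/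
noncomputable def conjSpan : Submodule R (MonoidAlgebra R W) :=
  Submodule.span R {a | ∃ J K, Conj cs J K ∧ x R cs J - x R cs K = a}

/-- The span of the `x_L` with `L ⊂ K`. -/
noncomputable def lowerSpan (K : Set B) : Submodule R (MonoidAlgebra R W) :=
  Submodule.span R (x R cs '' {L | L ⊂ K})

/-- The span of the `x_L` with `|L| < n`. -/
noncomputable def ncardSpan (n : ℕ) : Submodule R (MonoidAlgebra R W) :=
  Submodule.span R (x R cs '' {L | L.ncard < n})

theorem sub_mem_conjSpan {J K : Set B} (h : Conj cs J K) : x R cs J - x R cs K ∈ conjSpan R cs :=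
  Submodule.subset_span ⟨J, K, h, rfl⟩

theorem x_mem_lowerSpan {K L : Set B} (h : L ⊂ K) : x R cs L ∈ lowerSpan R cs K :=
  Submodule.subset_span ⟨L, h, rfl⟩

theorem x_mem_ncardSpan {n : ℕ} {L : Set B} (h : L.ncard < n) : x R cs L ∈ ncardSpan R cs n :=
  Submodule.subset_span ⟨L, h, rfl⟩

theorem x_mul_x_sub_mark_mem (J K : Set B) :
    x R cs J * x R cs K - (mark cs J K : R) • x R cs K ∈ lowerSpan R cs K := by
  classical
  rw [x_mul_x, ← Finset.sum_filter_add_sum_filter_not _ fun d => interConj cs J K d = K]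
  have : ∑ d ∈ doubleReps cs J K with interConj cs J K d = K, x R cs (interConj cs J K d) =
      (mark cs J K : R) • x R cs K := by
    rw [Finset.sum_congr rfl fun d hd => by rw [(Finset.mem_filter.mp hd).2], Finset.sum_const,
      mark, Nat.cast_smul_eq_nsmul]
  rw [this, add_sub_cancel_left]
  refine Submodule.sum_mem _ fun d hd => x_mem_lowerSpan R cs ?_
  exact (interConj_subset cs J K d).ssubset_of_ne (Finset.mem_filter.mp hd).2

theorem x_mul_mem_lowerSpan (J K : Set B) {v : MonoidAlgebra R W} (hv : v ∈ lowerSpan R cs K) :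
    x R cs J * v ∈ lowerSpan R cs K := by
  have : lowerSpan R cs K ≤
      (lowerSpan R cs K).comap (LinearMap.mulLeft R (x R cs J)) := by
    conv_lhs => rw [lowerSpan]
    rw [Submodule.span_le]
    rintro _ ⟨L, hL, rfl⟩
    simp only [Submodule.comap_coe, Set.mem_preimage, LinearMap.mulLeft_apply, SetLike.mem_coe]
    rw [x_mul_x]
    exact Submodule.sum_mem _ fun d _ =>
      x_mem_lowerSpan R cs ((interConj_subset cs J L d).trans_ssubset hL)
  exact this hv

theorem conj_sub_mul_x_mem {J J' : Set B} (h : Conj cs J J') (K : Set B) :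
    (x R cs J - x R cs J') * x R cs K ∈ lowerSpan R cs K := by
  have := Submodule.sub_mem _ (x_mul_x_sub_mark_mem R cs J K) (x_mul_x_sub_mark_mem R cs J' K)
  rwa [mark_eq_of_conj cs h, sub_sub_sub_cancel_right, ← sub_mul] at this

variable [Finite B]

theorem smul_x_mem_lowerSpan {K : Set B} {c : R} (h : c • x R cs K ∈ lowerSpan R cs K) :
    c = 0 := by
  refine (linearIndependent_x cs R).eq_zero_of_smul_mem_span K c (Submodule.span_mono ?_ h)
  exact Set.image_mono fun L hL => ⟨trivial, ne_of_lt hL⟩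

/-- The diagonal entries of the action are `∑ c J * mark J K`. Their vanishing forces the sum of `c`
over each conjugacy class to vanish, and cancelling nonzero integers needs no division. -/
theorem sum_mem_conjSpan [Fintype (Set B)] (c : Set B → ℤ)
    (h : ∀ K, (∑ J, c J • x ℤ cs J) * x ℤ cs K ∈ lowerSpan ℤ cs K) :
    ∑ J, c J • x ℤ cs J ∈ conjSpan ℤ cs := by
  classical
  have h1 : ∀ K, ∑ J, c J * mark cs J K = 0 := by
    intro K
    refine smul_x_mem_lowerSpan ℤ cs (K := K) ?_
    have h2 : ∑ J, c J • (x ℤ cs J * x ℤ cs K - (mark cs J K : ℤ) • x ℤ cs K) ∈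
        lowerSpan ℤ cs K :=
      Submodule.sum_mem _ fun J _ => Submodule.smul_mem _ _ (x_mul_x_sub_mark_mem ℤ cs J K)
    have h3 := Submodule.sub_mem _ (h K) h2
    convert h3 using 1
    simp only [smul_sub, Finset.sum_sub_distrib, Finset.sum_mul, Finset.sum_smul, smul_smul,
      smul_mul_assoc, sub_sub_cancel]
  have h2 : ∀ K, ∑ J with Conj cs J K, c J = 0 := by
    intro K
    -- Induct from large `K` downwards: besides the class of `K`, only classes of larger sets
    -- contribute.
    induction hn : Nat.card B - K.ncard using Nat.strong_induction_on generalizing K with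
    | _ n ih =>
      have hle : ∀ L : Set B, L.ncard ≤ Nat.card B := fun L => by
        rw [← Set.ncard_univ]; exact Set.ncard_le_ncard (Set.subset_univ L) (Set.toFinite _)
      let q : Set B → Quotient (conjSetoid cs) := Quotient.mk (conjSetoid cs)
      have hq : ∀ J L, q J = q L ↔ Conj cs J L := fun J L => Quotient.eq
      have hfib : ∀ L, ∑ J with q J = q L, c J * mark cs J K =
          (∑ J with Conj cs J L, c J) * mark cs L K := by
        intro L
        simp only [hq]
        rw [Finset.sum_mul]
        exact Finset.sum_congr rfl fun J hJ => by
          rw [mark_eq_of_conj cs (Finset.mem_filter.mp hJ).2]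
      have hsum := h1 K
      rw [← Finset.sum_fiberwise_of_maps_to (t := Finset.univ.image q)
        (fun J hJ => Finset.mem_image_of_mem q hJ), Finset.sum_eq_single (q K), hfib] at hsum
      · exact (mul_eq_zero.mp hsum).resolve_right
          (Nat.cast_ne_zero.mpr (mark_self_ne_zero cs K))
      · intro b hb hne
        obtain ⟨L, -, rfl⟩ := Finset.mem_image.mp hb
        rw [hfib]
        by_cases hm : mark cs L K = 0
        · simp [hm]
        · rcases ncard_lt_or_conj_of_mark_ne_zero cs hm with hlt | hc
          · rw [ih _ _ L rfl, zero_mul]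
            have := hle L
            omega
          · exact absurd ((hq L K).mpr hc) hne
      · simp
  let r : Set B → Set B := fun J => (Quotient.mk (conjSetoid cs) J).out
  have hr : ∀ J, Conj cs J (r J) := fun J => Conj.symm (Quotient.mk_out (s := conjSetoid cs) J)
  -- With zero class sums, replacing each `x_J` by its class representative gives zero, so this sum
  -- can be subtracted for free.
  have h3 : ∑ J, c J • x ℤ cs (r J) = 0 := by
    rw [← Finset.sum_fiberwise_of_maps_to (t := Finset.univ.image r)
        (fun J hJ => Finset.mem_image_of_mem r hJ)]
    refine Finset.sum_eq_zero fun K hK => ?_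
    obtain ⟨L, -, rfl⟩ := Finset.mem_image.mp hK
    rw [Finset.sum_congr rfl fun J hJ => by rw [(Finset.mem_filter.mp hJ).2], ← Finset.sum_smul]
    convert zero_smul ℤ (x ℤ cs (r L))
    rw [← h2 L]
    refine Finset.sum_congr (Finset.filter_congr fun J _ => ?_) fun _ _ => rfl
    refine ⟨fun he => (hr J).trans (he ▸ (hr L).symm), fun he => ?_⟩
    exact congrArg Quotient.out (Quotient.sound (s := conjSetoid cs) he)
  rw [← sub_zero (∑ J, c J • x ℤ cs J), ← h3, ← Finset.sum_sub_distrib]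
  refine Submodule.sum_mem _ fun J _ => ?_
  rw [← smul_sub]
  exact Submodule.smul_mem _ _ (sub_mem_conjSpan ℤ cs (hr J))

theorem x_mul_mem_conjSpan (J : Set B) {b : MonoidAlgebra ℤ W} (hb : b ∈ conjSpan ℤ cs) :
    x ℤ cs J * b ∈ conjSpan ℤ cs := by
  have hle : conjSpan ℤ cs ≤ (conjSpan ℤ cs).comap (LinearMap.mulLeft ℤ (x ℤ cs J)) := by
    conv_lhs => rw [conjSpan]
    rw [Submodule.span_le]
    rintro _ ⟨K, K', h, rfl⟩
    have hmem : ∀ L, x ℤ cs J * x ℤ cs L ∈ Submodule.span ℤ (Set.range (x ℤ cs)) := by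
      intro L
      rw [x_mul_x]
      exact Submodule.sum_mem _ fun d _ => Submodule.subset_span ⟨_, rfl⟩
    have := Fintype.ofFinite (Set B)
    obtain ⟨c, hc⟩ := (Submodule.mem_span_range_iff_exists_fun ℤ).mp
      (Submodule.sub_mem _ (hmem K) (hmem K'))
    simp only [Submodule.comap_coe, Set.mem_preimage, LinearMap.mulLeft_apply, SetLike.mem_coe]
    rw [mul_sub, ← hc]
    refine sum_mem_conjSpan cs c fun L => ?_
    rw [hc, ← mul_sub, mul_assoc]
    exact x_mul_mem_lowerSpan ℤ cs J L (conj_sub_mul_x_mem ℤ cs h L)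
  exact hle hb

theorem mul_mem_conjSpan {a b : MonoidAlgebra ℤ W} (ha : a ∈ conjSpan ℤ cs)
    (hb : b ∈ conjSpan ℤ cs) : a * b ∈ conjSpan ℤ cs := by
  have hle : conjSpan ℤ cs ≤ (conjSpan ℤ cs).comap (LinearMap.mulRight ℤ b) := by
    conv_lhs => rw [conjSpan]
    rw [Submodule.span_le]
    rintro _ ⟨J, J', -, rfl⟩
    simp only [Submodule.comap_coe, Set.mem_preimage, LinearMap.mulRight_apply, SetLike.mem_coe]
    rw [sub_mul]
    exact Submodule.sub_mem _ (x_mul_mem_conjSpan cs J hb) (x_mul_mem_conjSpan cs J' hb)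
  exact hle ha

theorem xProd_mem_conjSpan {n : ℕ} (hn : 0 < n) (p : PairSeq cs n) :
    xProd ℤ cs p ∈ conjSpan ℤ cs := by
  have key : ∀ l : List (MonoidAlgebra ℤ W), l ≠ [] → (∀ a ∈ l, a ∈ conjSpan ℤ cs) →
      l.prod ∈ conjSpan ℤ cs := by
    intro l
    induction l with
    | nil => simp
    | cons a l ih =>
      intro _ hl
      rcases eq_or_ne l [] with rfl | hne
      · simpa using hl
      · rw [List.prod_cons]
        exact mul_mem_conjSpan cs (hl a (by simp)) (ih hne fun b hb => hl b (by simp [hb]))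
  refine key _ ?_ fun a ha => ?_
  · rw [Ne, List.ofFn_eq_nil_iff]
    -- Length zero is excluded: the empty product is `1`, which is not in the span.
    exact hn.ne'
  · obtain ⟨i, rfl⟩ := (List.mem_ofFn' _ _).mp ha
    exact sub_mem_conjSpan ℤ cs (p.2 i)

end Ideal

/-! ### Conjugate differences lie in the Jacobson radical. -/

section Radical

variable {B : Type*} [Finite B] {M : CoxeterMatrix B} {W : Type*} [Group W] [Fintype W]
  (R : Type*) [CommRing R] (cs : CoxeterSystem M W)

theorem x_mul_mem_ncardSpan (J : Set B) (n : ℕ) {v : MonoidAlgebra R W}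
    (hv : v ∈ ncardSpan R cs n) : x R cs J * v ∈ ncardSpan R cs n := by
  have : ncardSpan R cs n ≤
      (ncardSpan R cs n).comap (LinearMap.mulLeft R (x R cs J)) := by
    conv_lhs => rw [ncardSpan]
    rw [Submodule.span_le]
    rintro _ ⟨L, hL, rfl⟩
    simp only [Submodule.comap_coe, Set.mem_preimage, LinearMap.mulLeft_apply, SetLike.mem_coe]
    rw [x_mul_x]
    exact Submodule.sum_mem _ fun d _ => x_mem_ncardSpan R cs
      ((Set.ncard_le_ncard (interConj_subset cs J L d) (Set.toFinite _)).trans_lt hL)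
  exact this hv

theorem descentAlgebra_mul_mem_ncardSpan {y : MonoidAlgebra R W} (hy : y ∈ descentAlgebra R cs)
    (n : ℕ) {v : MonoidAlgebra R W} (hv : v ∈ ncardSpan R cs n) : y * v ∈ ncardSpan R cs n := by
  rw [descentAlgebra] at hy
  induction hy using Algebra.adjoin_induction generalizing v with
  | mem y hy =>
    obtain ⟨J, rfl⟩ := hy
    exact x_mul_mem_ncardSpan R cs J n hv
  | algebraMap r =>
    rw [← Algebra.smul_def]
    exact Submodule.smul_mem _ _ hv
  | add a b _ _ ha hb =>
    rw [add_mul]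
    exact Submodule.add_mem _ (ha hv) (hb hv)
  | mul a b _ _ ha hb =>
    rw [mul_assoc]
    exact ha (hb hv)

theorem conj_sub_mul_mem_ncardSpan {J J' : Set B} (h : Conj cs J J') (n : ℕ)
    {v : MonoidAlgebra R W} (hv : v ∈ ncardSpan R cs (n + 1)) :
    (x R cs J - x R cs J') * v ∈ ncardSpan R cs n := by
  have : ncardSpan R cs (n + 1) ≤
      (ncardSpan R cs n).comap (LinearMap.mulLeft R (x R cs J - x R cs J')) := by
    conv_lhs => rw [ncardSpan]
    rw [Submodule.span_le]
    rintro _ ⟨K, hK, rfl⟩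
    refine Submodule.span_mono (Set.image_mono fun L hL => ?_) (conj_sub_mul_x_mem R cs h K)
    have := Set.ncard_lt_ncard hL (Set.toFinite _)
    have hK' : K.ncard < n + 1 := hK
    change L.ncard < n
    omega
  exact this hv

/-- The difference lowers the filtration by cardinality by one step and `y` preserves it. Evaluating
at `1 = x_S`, which lies in the top step, shows that a power vanishes. -/
theorem isNilpotent_mul_conj_sub (y : descentAlgebra R cs) {J J' : Set B} (h : Conj cs J J') :
    IsNilpotent (y * (xD R cs J - xD R cs J')) := by
  have key : ∀ (m : ℕ) (v : MonoidAlgebra R W), v ∈ ncardSpan R cs m →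
      ((y : MonoidAlgebra R W) * (x R cs J - x R cs J')) ^ m * v = 0 := by
    intro m
    induction m with
    | zero =>
      intro v hv
      simpa [ncardSpan] using hv
    | succ m ih =>
      intro v hv
      rw [pow_succ, mul_assoc, mul_assoc]
      exact ih _ (descentAlgebra_mul_mem_ncardSpan R cs y.2 m
        (conj_sub_mul_mem_ncardSpan R cs h m hv))
  refine ⟨(Set.univ : Set B).ncard + 1, Subtype.ext ?_⟩
  have := key _ (x R cs Set.univ) (x_mem_ncardSpan R cs (Nat.lt_succ_self _))
  rw [x_univ, mul_one] at this
  exact this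

theorem xD_sub_xD_mem_jacobson {J J' : Set B} (h : Conj cs J J') :
    xD R cs J - xD R cs J' ∈ Ring.jacobson (descentAlgebra R cs) := by
  rw [← Ideal.jacobson_bot, Ideal.mem_jacobson_iff]
  intro y
  obtain ⟨u, hu⟩ := (isNilpotent_mul_conj_sub R cs y h).isUnit_one_add
  refine ⟨↑u⁻¹, ?_⟩
  rw [Ideal.mem_bot, mul_assoc, add_comm, ← mul_one_add, ← hu, Units.inv_mul, sub_self]

end Radical

/-! ### Divisibility of minors under multiplication. -/

section Minors

theorem dvd_det_submatrix_mul {m n o : Type*} [Fintype n] {s : ℕ} {g : ℤ}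
    (A : Matrix m n ℤ) (P : Matrix n o ℤ) (q : Fin s → m) (r : Fin s → o)
    (h : ∀ f : Fin s ↪ n, g ∣ (A.submatrix q f).det) : g ∣ ((A * P).submatrix q r).det := by
  classical
  have hrow : ((A * P).submatrix q r).transpose =
      fun i => ∑ j, P j (r i) • fun i' => A (q i') j := by
    ext i i'
    simp [Matrix.mul_apply, mul_comm]
  -- Multilinear expansion in the columns, after a transpose since `Matrix.detRowAlternating` works
  -- on rows. Terms with non-injective `f` have a repeated column.
  have hexp : ((A * P).submatrix q r).det =
      ∑ f : Fin s → n, (∏ i, P (f i) (r i)) * (A.submatrix q f).det := by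
    rw [← Matrix.det_transpose, hrow]
    refine ((Matrix.detRowAlternating (n := Fin s) (R := ℤ)).toMultilinearMap.map_sum
      (fun i j => P j (r i) • fun i' => A (q i') j)).trans
      (Finset.sum_congr rfl fun f _ => ?_)
    refine ((Matrix.detRowAlternating (n := Fin s) (R := ℤ)).toMultilinearMap.map_smul_univ
      (fun i => P (f i) (r i)) (fun i i' => A (q i') (f i))).trans ?_
    rw [smul_eq_mul, ← Matrix.det_transpose (A.submatrix q f)]
    rfl
  rw [hexp]
  refine Finset.dvd_sum fun f _ => Dvd.dvd.mul_left ?_ _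
  by_cases hf : Function.Injective f
  · exact h ⟨f, hf⟩
  · rw [Function.Injective] at hf
    push Not at hf
    obtain ⟨i, j, hij, hne⟩ := hf
    rw [Matrix.det_zero_of_column_eq hne fun k => by simp [hij]]
    exact dvd_zero g

theorem minorGcd_dvd_minorGcd_mul {m n o : Type*} [Fintype m] [Fintype n] [Fintype o] (s : ℕ)
    (A : Matrix m n ℤ) (P : Matrix n o ℤ) : minorGcd s A ∣ minorGcd s (A * P) := by
  classical
  rw [minorGcd, minorGcd, Int.natAbs_dvd_natAbs]
  refine Finset.dvd_gcd fun q _ => dvd_det_submatrix_mul A P q.1 q.2 fun f => ?_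
  exact Finset.gcd_dvd (f := fun q : (Fin s ↪ m) × (Fin s ↪ n) => (A.submatrix q.1 q.2).det)
    (Finset.mem_univ (q.1, f))

end Minors

/-! ### Incidence vectors of a graph over different rings. -/

section Edges

variable {X ι : Type*}

/-- The signed incidence vectors of a family of edges. -/
noncomputable def edgeVec (R : Type*) [CommRing R] (e : ι → X × X) (i : ι) : X →₀ R :=
  Finsupp.single (e i).1 1 - Finsupp.single (e i).2 1

theorem single_sub_single_mem_span_edgeVec (k : Type*) [CommRing k] [Nontrivial k]
    (e : ι → X × X) {a b : X}
    (h : Finsupp.single a 1 - Finsupp.single b 1 ∈ Submodule.span k (Set.range (edgeVec k e))) :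
    Finsupp.single a 1 - Finsupp.single b 1 ∈ Submodule.span ℤ (Set.range (edgeVec ℤ e)) := by
  classical
  set S := Submodule.span ℤ (Set.range (edgeVec ℤ e)) with hS
  -- The indicator of the vertices integrally connected to `a`. It agrees at both ends of every
  -- edge, so it kills the span, but it takes the value `1` on `a - b` if `b` is not connected to
  -- `a`.
  let f : (X →₀ k) →ₗ[k] k := Finsupp.linearCombination k fun c =>
    if Finsupp.single a 1 - Finsupp.single c 1 ∈ S then 1 else 0
  have hf : ∀ v ∈ Submodule.span k (Set.range (edgeVec k e)), f v = 0 := by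
    intro v hv
    have : Submodule.span k (Set.range (edgeVec k e)) ≤ LinearMap.ker f := by
      rw [Submodule.span_le]
      rintro _ ⟨i, rfl⟩
      have hi : edgeVec ℤ e i ∈ S := Submodule.subset_span ⟨i, rfl⟩
      have hiff : Finsupp.single a 1 - Finsupp.single (e i).1 1 ∈ S ↔
          Finsupp.single a 1 - Finsupp.single (e i).2 1 ∈ S := by
        rw [← Submodule.add_mem_iff_left S hi, edgeVec, sub_add_sub_cancel]
      simp [f, edgeVec, hiff]
    exact this hv
  have h0 := hf _ h
  by_contra hb
  simp [f, hb] at h0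

theorem linearIndependent_edgeVec_int [Fintype ι] (k : Type*) [CommRing k] [Nontrivial k]
    (e : ι → X × X) (h : LinearIndependent k (edgeVec k e)) :
    LinearIndependent ℤ (edgeVec ℤ e) := by
  rw [Fintype.linearIndependent_iff] at h ⊢
  intro n hn
  by_contra! hne
  obtain ⟨i₀, hi₀⟩ := hne
  -- Make the relation primitive. Its image over `k` is trivial, so the characteristic divides every
  -- coefficient and hence their gcd `1`; this also covers characteristic zero.
  obtain ⟨g, hg, hg1⟩ := Finset.extract_gcd n (s := Finset.univ) ⟨i₀, Finset.mem_univ _⟩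
  have hG : Finset.univ.gcd n ≠ 0 := by
    intro h0
    exact hi₀ (Finset.gcd_eq_zero_iff.mp h0 i₀ (Finset.mem_univ _))
  have hsum : ∑ i, g i • edgeVec ℤ e i = 0 := by
    have : Finset.univ.gcd n • ∑ i, g i • edgeVec ℤ e i = 0 := by
      rw [Finset.smul_sum, ← hn]
      exact Finset.sum_congr rfl fun i hi => by rw [smul_smul, ← hg i hi]
    exact (smul_eq_zero.mp this).resolve_left hG
  have hk : ∑ i, (g i : k) • edgeVec k e i = 0 := by
    classical
    ext p
    have := congrArg (fun v => ((v p : ℤ) : k)) hsum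
    simpa [edgeVec, Finsupp.finsetSum_apply, Finsupp.single_apply] using this
  have hdvd : (ringChar k : ℤ) ∣ Finset.univ.gcd g :=
    Finset.dvd_gcd fun i _ => (CharP.intCast_eq_zero_iff k (ringChar k) (g i)).mp (h _ hk i)
  rw [hg1, ← CharP.intCast_eq_zero_iff k, Int.cast_one] at hdvd
  exact one_ne_zero hdvd

end Edges

/-! ### From a basis over the field to integral coefficient matrices. -/

section RadBasis

variable {B : Type*} {M : CoxeterMatrix B} {W : Type*} [Group W] [Fintype W]
  {cs : CoxeterSystem M W} {k : Type*} [Field k] {Ω : Finset (Set B × Set B)}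

theorem linearCombination_x_comp_edgeVec (R : Type*) [CommRing R] (cs : CoxeterSystem M W)
    (Ω : Finset (Set B × Set B)) :
    Finsupp.linearCombination R (x R cs) ∘ edgeVec R (fun ω : Ω => ω.1) =
      fun ω : Ω => x R cs ω.1.1 - x R cs ω.1.2 := by
  funext ω
  simp [edgeVec]

theorem linearCombination_x_single_sub (R : Type*) [CommRing R] (cs : CoxeterSystem M W)
    (J K : Set B) : Finsupp.linearCombination R (x R cs) (Finsupp.single J 1 - Finsupp.single K 1) =
      x R cs J - x R cs K := by
  simp

theorem IsRadBasis.linearIndependent_edgeVec (h : IsRadBasis k cs Ω) :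
    LinearIndependent k (edgeVec k fun ω : Ω => ω.1) := by
  refine LinearIndependent.of_comp (Finsupp.linearCombination k (x k cs)) ?_
  rw [linearCombination_x_comp_edgeVec]
  exact h.linearIndependent.map' (descentAlgebra k cs).val.toLinearMap
    (LinearMap.ker_eq_bot.mpr Subtype.val_injective)

variable [Finite B]

/-- The difference lies in the radical, which `Ω` spans; independence of the `x_J` pulls this
relation back to incidence vectors. -/
theorem IsRadBasis.single_sub_single_mem_span (h : IsRadBasis k cs Ω) {J K : Set B}
    (hc : Conj cs J K) : Finsupp.single J 1 - Finsupp.single K 1 ∈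
      Submodule.span k (Set.range (edgeVec k fun ω : Ω => ω.1)) := by
  have h1 : xD k cs J - xD k cs K ∈
      Submodule.span k (Set.range fun ω : Ω => xD k cs ω.1.1 - xD k cs ω.1.2) := by
    rw [h.span_eq]
    exact xD_sub_xD_mem_jacobson k cs hc
  have h2 := Submodule.mem_map_of_mem (f := (descentAlgebra k cs).val.toLinearMap) h1
  rw [Submodule.map_span, ← Set.range_comp] at h2
  have h3 : x k cs J - x k cs K ∈
      Submodule.span k (Set.range fun ω : Ω => x k cs ω.1.1 - x k cs ω.1.2) := h2
  rw [← linearCombination_x_comp_edgeVec, Set.range_comp, ← Submodule.map_span,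
    ← linearCombination_x_single_sub] at h3
  obtain ⟨v, hv, he⟩ := h3
  rwa [← linearIndependent_x cs k he]

theorem IsRadBasis.linearIndependent_int (h : IsRadBasis k cs Ω) :
    LinearIndependent ℤ fun ω : Ω => x ℤ cs ω.1.1 - x ℤ cs ω.1.2 := by
  rw [← linearCombination_x_comp_edgeVec]
  exact (linearIndependent_edgeVec_int k _ h.linearIndependent_edgeVec).map' _
    (LinearMap.ker_eq_bot.mpr (linearIndependent_x cs ℤ))

theorem IsRadBasis.conjSpan_le (h : IsRadBasis k cs Ω) :
    conjSpan ℤ cs ≤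
      Submodule.span ℤ (Set.range fun ω : Ω => x ℤ cs ω.1.1 - x ℤ cs ω.1.2) := by
  rw [← linearCombination_x_comp_edgeVec, Set.range_comp, ← Submodule.map_span, conjSpan,
    Submodule.span_le]
  rintro _ ⟨J, K, hc, rfl⟩
  rw [← linearCombination_x_single_sub]
  exact Submodule.mem_map_of_mem
    (single_sub_single_mem_span_edgeVec k _ (h.single_sub_single_mem_span hc))

theorem IsRadBasis.exists_coeff (h : IsRadBasis k cs Ω) {a : MonoidAlgebra ℤ W}
    (ha : a ∈ conjSpan ℤ cs) :
    ∃ c : Ω → ℤ, a = ∑ ω : Ω, c ω • (x ℤ cs ω.1.1 - x ℤ cs ω.1.2) := by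
  obtain ⟨c, hc⟩ := (Submodule.mem_span_range_iff_exists_fun ℤ).mp (h.conjSpan_le ha)
  exact ⟨c, hc.symm⟩

theorem IsRadBasis.existsUnique_isCoeffMatrix (h : IsRadBasis k cs Ω) {n : ℕ} (hn : 0 < n) :
    ∃! A, IsCoeffMatrix cs n Ω A := by
  choose A hA using fun p : PairSeq cs n => h.exists_coeff (xProd_mem_conjSpan cs hn p)
  refine ⟨A, hA, fun A' hA' => ?_⟩
  funext p
  exact funext (Fintype.linearIndependent_iffₛ.mp h.linearIndependent_int _ _
    ((hA' p).symm.trans (hA p)))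

theorem IsRadBasis.isCoeffMatrix_coeffMatrix (h : IsRadBasis k cs Ω) {n : ℕ} (hn : 0 < n) :
    IsCoeffMatrix cs n Ω (coeffMatrix cs n Ω) := by
  have hex := (h.existsUnique_isCoeffMatrix hn).exists
  rw [coeffMatrix, dif_pos hex]
  exact hex.choose_spec

/-- The coefficient matrices of two bases differ by an integral change of basis. -/
theorem IsRadBasis.exists_coeffMatrix_eq_mul (h : IsRadBasis k cs Ω)
    {Ω' : Finset (Set B × Set B)} (h' : IsRadBasis k cs Ω') {n : ℕ} (hn : 0 < n) :
    ∃ P : Matrix Ω' Ω ℤ, coeffMatrix cs n Ω = coeffMatrix cs n Ω' * P := by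
  choose P' hP using fun ω' : Ω' =>
    h.exists_coeff (sub_mem_conjSpan ℤ cs (h'.conj ω'.1 ω'.2))
  let P : Matrix Ω' Ω ℤ := Matrix.of P'
  refine ⟨P, (h.existsUnique_isCoeffMatrix hn).unique (h.isCoeffMatrix_coeffMatrix hn) ?_⟩
  intro p
  calc xProd ℤ cs p
      = ∑ ω' : Ω', coeffMatrix cs n Ω' p ω' •
          ∑ ω : Ω, P ω' ω • (x ℤ cs ω.1.1 - x ℤ cs ω.1.2) := by
        rw [h'.isCoeffMatrix_coeffMatrix hn p]
        exact Finset.sum_congr rfl fun ω' _ => congrArg _ (hP ω')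
    _ = ∑ ω : Ω, (coeffMatrix cs n Ω' * P) p ω • (x ℤ cs ω.1.1 - x ℤ cs ω.1.2) := by
        simp only [Finset.smul_sum, smul_smul]
        rw [Finset.sum_comm]
        exact Finset.sum_congr rfl fun ω _ => by rw [Matrix.mul_apply, Finset.sum_smul]

end RadBasis

/-! ### Independence of the choice of basis. -/

section Invariance

variable {B : Type*} [Fintype B] {M : CoxeterMatrix B} {W : Type*} [Group W] [Fintype W]
  {cs : CoxeterSystem M W} {k : Type*} [Field k] {Ω Ω' : Finset (Set B × Set B)}

open Classical in
theorem IsRadBasis.dW_dvd_dW (h : IsRadBasis k cs Ω) (h' : IsRadBasis k cs Ω') {n : ℕ}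
    (hn : 0 < n) : dW k cs Ω' n ∣ dW k cs Ω n := by
  obtain ⟨P, hP⟩ := h.exists_coeffMatrix_eq_mul h' hn
  rw [dW, dW, hP]
  exact minorGcd_dvd_minorGcd_mul _ _ P

theorem IsRadBasis.dW_eq (h : IsRadBasis k cs Ω) (h' : IsRadBasis k cs Ω') {n : ℕ}
    (hn : 0 < n) : dW k cs Ω n = dW k cs Ω' n :=
  Nat.dvd_antisymm (h'.dW_dvd_dW h hn) (h.dW_dvd_dW h' hn)

theorem IsRadBasis.nW_eq (h : IsRadBasis k cs Ω) (h' : IsRadBasis k cs Ω') :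
    nW k cs Ω = nW k cs Ω' := by
  rw [nW, nW]
  congr 1
  refine Finset.lcm_congr rfl fun n hn => ?_
  rw [nWn, nWn, h.dW_eq h' (Finset.mem_Icc.mp hn).1]

end Invariance

end Descent

/-- For two bases of the radical within `J(1)`, the integer matrices `[J(n)]` are well defined,
and the numbers `d_{W,n}` (for all `n ≥ 1`) and `n_W` computed with them agree. -/
theorem corollary9p4 {B : Type*} [Fintype B] {M : CoxeterMatrix B} {W : Type*} [Group W]
    [Fintype W] (cs : CoxeterSystem M W) (k : Type*) [Field k]
    (Ω Ω' : Finset (Set B × Set B))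
    (hΩ : Descent.IsRadBasis k cs Ω) (hΩ' : Descent.IsRadBasis k cs Ω') :
    (∀ n : ℕ, 0 < n →
      (∃! A, Descent.IsCoeffMatrix cs n Ω A) ∧ (∃! A, Descent.IsCoeffMatrix cs n Ω' A) ∧
      Descent.dW k cs Ω n = Descent.dW k cs Ω' n) ∧
    Descent.nW k cs Ω = Descent.nW k cs Ω' :=
  ⟨fun _ hn => ⟨hΩ.existsUnique_isCoeffMatrix hn, hΩ'.existsUnique_isCoeffMatrix hn,
    hΩ.dW_eq hΩ' hn⟩, hΩ.nW_eq hΩ'⟩
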